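/- **Setting.** Let $\mathcal G$ be a finite set of network nodes with a subset $\mathcal S\subseteq\mathcal G$ of sensor nodes (the other nodes are communication nodes), and let $\mathbf\Pi=(\pi^{s,j})_{s,j\in\mathcal G}$ be a consensus matrix. Consider in $\mathbb R^n$ the linear stochastic system $$x_{k+1}=F_kx_k+w_k,\qquad y_{k,s}=\beta_{k,s}Hx_k+v_{k,s}\in\mathbb R^2\quad(s\in\mathcal S),\qquad k\ge 0,$$ where $\beta_{k,s}=\mathrm{diag}(\beta^1_{k,s},\beta^2_{k,s})$, $w_k$ and $v_{k,s}$ are square-integrable zero-mean noises with covariances $Q_k$ and $R_{k,s}$ (for instance Gaussian; no independence is needed), and $x_0$ is square integrable. **The CM filter.** Every node $s$ starts with a prior information matrix $\Omega_{1|0,s}$ and a square-integrable estimate $\hat x_{1|0,s}$, and $q_{1|0,s}=\Omega_{1|0,s}\hat x_{1|0,s}$. At time $k\ge1$ put, for $s\in\mathcal S$, $$\delta\Omega_{k,s}=(\beta_{k,s}H)^{\mathsf T}R_{k,s}^{-1}\beta_{k,s}H,\qquad \delta q_{k,s}=(\beta_{k,s}H)^{\mathsf T}R_{k,s}^{-1}y_{k,s},$$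 and $\delta\Omega_{k,s}=0$, $\delta q_{k,s}=0$ for $s\notin\mathcal S$. Each of these families undergoes $L$ consensus iterations $a_s(l+1)=\sum_{j\in\mathcal G}\pi^{s,j}a_j(l)$, $a_s(0)=a_s$. With weights $\omega_{k,s}$, the correction step is $$\Omega_{k|k,s}=\Omega_{k|k-1,s}+\omega_{k,s}\,\delta\Omega_{k,s}(L),\qquad q_{k|k,s}=q_{k|k-1,s}+\omega_{k,s}\,\delta q_{k,s}(L),\qquad \hat x_{k|k,s}=\Omega_{k|k,s}^{-1}q_{k|k,s},$$ and the prediction step is, with $W_k=Q_k^{-1}$, $$\Omega_{k+1|k,s}=W_k-W_kF_k(\Omega_{k|k,s}+F_k^{\mathsf T}W_kF_k)^{-1}F_k^{\mathsf T}W_k,\qquad q_{k+1|k,s}=\Omega_{k+1|k,s}F_k\Omega_{k|k,s}^{-1}q_{k|k,s}.$$ **Assumptions** (matrix inequalities in the Loewner order). A1. There are nonzero reals $\underline\beta,\overline\beta,\underline f,\overline f,\underline h,\overline h$ such that, for all $k\ge0$ and $s\in\mathcal S$, $\underline\beta^2I\le\beta_{k,s}\beta_{k,s}^{\mathsf T}\le\overline\beta^2I$,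 $\underline f^2I\le F_kF_k^{\mathsf T}\le\overline f^2I$, and $\underline h^2I\le HH^{\mathsf T}\le\overline h^2I$. A2. There are reals $0<\underline\omega\le\overline\omega$, $0<\underline q\le\overline q$, $0<\underline r\le\overline r$, $0<\underline p\le\overline p$ such that, for all times $k$, $\underline\omega\le\omega_{k,s}\le\overline\omega$ $(s\in\mathcal G)$, $\underline qI\le Q_k\le\overline qI$, $\underline rI\le R_{k,s}\le\overline rI$ $(s\in\mathcal S)$, and, for $k\ge1$, $\underline pI\le\Omega_{k|k,s}\le\overline pI$ $(s\in\mathcal G)$. A3. $\mathbf\Pi$ is doubly stochastic and primitive (nonnegative, with some power entrywise positive). **Theorem 1.** Under A1–A3, if $L>1$ and $\Omega_{1|0,s}>0$ for every $s\in\mathcal G$, then for every $s\in\mathcal G$ the estimation error $e_{k+1,s}=x_{k+1}-\hat x_{k+1|k+1,s}$ is square integrable for every $k\ge0$ and asymptotically bounded in the mean square: $$\limsup_{k\to\infty}\mathbb E\|e_{k+1,s}\|^2<\infty .$$ -/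

import Mathlib

open MeasureTheory ProbabilityTheory Filter Matrix

noncomputable section

/-- Deterministic data of the linear system with consensus-on-measurement (CM) filter over a finite
network with node set `V` and an `n`-dimensional kinematic state; measurements are planar. -/
structure CMData (V : Type*) (n : ℕ) where
  /-- state transition matrices `F_k` -/
  F : ℕ → Matrix (Fin n) (Fin n) ℝ
  /-- measurement matrix `H` -/
  H : Matrix (Fin 2) (Fin n) ℝ
  /-- diagonal `(β¹_{k,s}, β²_{k,s})` of the compensation matrix -/
  β : ℕ → V → Fin 2 → ℝ
  /-- process noise covariances `Q_k` -/
  Q : ℕ → Matrix (Fin n) (Fin n) ℝ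
  /-- measurement noise covariances `R_{k,s}` -/
  R : ℕ → V → Matrix (Fin 2) (Fin 2) ℝ
  /-- the set of sensor nodes; the other nodes are communication nodes, without measurements -/
  sensors : Set V
  /-- consensus matrix -/
  Pi : Matrix V V ℝ
  /-- number of consensus iterations -/
  L : ℕ
  /-- CM weights `ω_{k,s}` -/
  weight : ℕ → V → ℝ
  /-- prior information matrices `Ω_{1|0,s}` -/
  info₁ : V → Matrix (Fin n) (Fin n) ℝ

namespace CMData

variable {V : Type*} {n : ℕ} (D : CMData V n)

/-- The compensation matrix `β_{k,s} = diag(β¹_{k,s}, β²_{k,s})`. -/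
def comp (k : ℕ) (s : V) : Matrix (Fin 2) (Fin 2) ℝ := Matrix.diagonal (D.β k s)

/-- The measurement matrix `β_{k,s} H` of node `s` at time `k`. -/
def measMat (k : ℕ) (s : V) : Matrix (Fin 2) (Fin n) ℝ := D.comp k s * D.H

open Classical in
/-- Local innovation part `δΩ_{k,s}` of the information matrix; it is `0` on communication nodes. -/
def innovInfo (k : ℕ) (s : V) : Matrix (Fin n) (Fin n) ℝ :=
  if s ∈ D.sensors then (D.measMat k s)ᵀ * (D.R k s)⁻¹ * D.measMat k s else 0

open Classical in
/-- Local innovation part `δq_{k,s}` of the information vector, for the measurement vector `y`;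
it is `0` on communication nodes. -/
def innovVec (k : ℕ) (s : V) (y : Fin 2 → ℝ) : Fin n → ℝ :=
  if s ∈ D.sensors then ((D.measMat k s)ᵀ * (D.R k s)⁻¹) *ᵥ y else 0

/-- `l` consensus iterations `a_s(l+1) = ∑_j π^{s,j} a_j(l)` started at `a`. -/
def consensus [Fintype V] {E : Type*} [AddCommMonoid E] [Module ℝ E] (a : V → E) : ℕ → V → E
  | 0 => a
  | l + 1 => fun s => ∑ j, D.Pi s j • consensus a l j

/-- Correction of the information matrix at time `k`, from the predicted one `P`. -/
def correctInfo [Fintype V] (k : ℕ) (P : V → Matrix (Fin n) (Fin n) ℝ) (s : V) :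
    Matrix (Fin n) (Fin n) ℝ :=
  P s + D.weight k s • D.consensus (D.innovInfo k) D.L s

/-- Correction of the information vector at time `k`, from the predicted one `q` and the
measurements `y`. -/
def correctVec [Fintype V] (k : ℕ) (q : V → Fin n → ℝ) (y : V → Fin 2 → ℝ) (s : V) : Fin n → ℝ :=
  q s + D.weight k s • D.consensus (fun j => D.innovVec k j (y j)) D.L s

/-- Time update `W - W F (Ω + Fᵀ W F)⁻¹ Fᵀ W`, `W = Q⁻¹`, of the information matrix. -/
def predictInfo (k : ℕ) (P : Matrix (Fin n) (Fin n) ℝ) : Matrix (Fin n) (Fin n) ℝ :=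
  (D.Q k)⁻¹ - (D.Q k)⁻¹ * D.F k * (P + (D.F k)ᵀ * (D.Q k)⁻¹ * D.F k)⁻¹ * (D.F k)ᵀ * (D.Q k)⁻¹

/-- Predicted information matrix `Ω_{k+1|k,s}`, for `k = 0, 1, 2, …`. -/
def priorInfo [Fintype V] : ℕ → V → Matrix (Fin n) (Fin n) ℝ
  | 0 => D.info₁
  | k + 1 => fun s => D.predictInfo (k + 1) (D.correctInfo (k + 1) (priorInfo k) s)

/-- Updated information matrix `Ω_{k+1|k+1,s}`, for `k = 0, 1, 2, …`. -/
def postInfo [Fintype V] (k : ℕ) : V → Matrix (Fin n) (Fin n) ℝ :=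
  D.correctInfo (k + 1) (D.priorInfo k)

/-- Predicted information vector `q_{k+1|k,s}`, for `k = 0, 1, 2, …`, for the initial estimates
`xhat₁ s = x̂_{1|0,s}` and the measurements `y`. -/
def priorVec [Fintype V] (xhat₁ : V → Fin n → ℝ) (y : ℕ → V → Fin 2 → ℝ) : ℕ → V → Fin n → ℝ
  | 0 => fun s => D.info₁ s *ᵥ xhat₁ s
  | k + 1 => fun s =>
      (D.priorInfo (k + 1) s * D.F (k + 1) * (D.postInfo k s)⁻¹) *ᵥ
        D.correctVec (k + 1) (priorVec xhat₁ y k) (y (k + 1)) s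

/-- Estimate `x̂_{k+1|k+1,s} = Ω_{k+1|k+1,s}⁻¹ q_{k+1|k+1,s}`, for `k = 0, 1, 2, …`. -/
def estimate [Fintype V] (xhat₁ : V → Fin n → ℝ) (y : ℕ → V → Fin 2 → ℝ) (k : ℕ) (s : V) :
    Fin n → ℝ :=
  (D.postInfo k s)⁻¹ *ᵥ D.correctVec (k + 1) (D.priorVec xhat₁ y k) (y (k + 1)) s

/-- State `x_k`: `x_{k+1} = F_k x_k + w_k`. -/
def state (x₀ : Fin n → ℝ) (w : ℕ → Fin n → ℝ) : ℕ → Fin n → ℝ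
  | 0 => x₀
  | k + 1 => D.F k *ᵥ state x₀ w k + w k

/-- Measurement `y_{k,s} = β_{k,s} H x_k + v_{k,s}`. -/
def meas (x₀ : Fin n → ℝ) (w : ℕ → Fin n → ℝ) (v : ℕ → V → Fin 2 → ℝ) (k : ℕ) (s : V) :
    Fin 2 → ℝ :=
  D.measMat k s *ᵥ D.state x₀ w k + v k s

/-- Estimation error `e_{k+1,s} = x_{k+1} - x̂_{k+1|k+1,s}`, for `k = 0, 1, 2, …`, as a vector of
Euclidean space. -/
def error [Fintype V] (x₀ : Fin n → ℝ) (w : ℕ → Fin n → ℝ) (v : ℕ → V → Fin 2 → ℝ)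
    (xhat₁ : V → Fin n → ℝ) (k : ℕ) (s : V) : EuclideanSpace ℝ (Fin n) :=
  WithLp.toLp 2 (D.state x₀ w (k + 1) - D.estimate xhat₁ (D.meas x₀ w v) k s)

end CMData

/-- `a I ≤ A ≤ b I` in the Loewner order. -/
def LoewnerBetween {m : ℕ} (a b : ℝ) (A : Matrix (Fin m) (Fin m) ℝ) : Prop :=
  (A - a • (1 : Matrix (Fin m) (Fin m) ℝ)).PosSemidef ∧
    (b • (1 : Matrix (Fin m) (Fin m) ℝ) - A).PosSemidef

/-- `X` is a square-integrable random vector with mean zero and covariance matrix `C`. -/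
def IsZeroMeanNoise {S : Type*} [MeasurableSpace S] (μ : Measure S) {m : ℕ}
    (X : S → Fin m → ℝ) (C : Matrix (Fin m) (Fin m) ℝ) : Prop :=
  (∀ i, MemLp (fun z => X z i) 2 μ) ∧ (∀ i, ∫ z, X z i ∂μ = 0) ∧
    ∀ i j, covariance (fun z => X z i) (fun z => X z j) μ = C i j

end

/-! ### Quadratic-form inequalities behind the Lyapunov argument. -/

section QuadraticForms

variable {m n : ℕ}

/-! At a fixed node the function `W k = eᵀ Ω e`, with `e` the current error and `Ω` the updated
information matrix, is a stochastic Lyapunov function. Consensus averages only the innovations, so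
the errors of different nodes are not coupled (`postInfo_mulVec_error`).

Prediction turns the inverse of `Ω` into `Q + F Ω⁻¹ Fᵀ`. Since `Q ≥ q` while `F Ω⁻¹ Fᵀ ≤ f / p`, the
weighted error shrinks by the uniform factor `κ = 1 + q p / f > 1` (`quadForm_predict_le`).
Correction adds a positive semidefinite term and so does not increase it
(`quadForm_le_of_add_mulVec_eq`).

The noise is split off by Young's inequality with a parameter `t` between `1 / κ` and `1`
(`quadForm_step_le`), which needs no independence. In expectation, `W (k + 1) ≤ W k / (κ t) + G`,
where `G` comes from the covariance bounds. As `κ t > 1`, the sequence is bounded, and `Ω ≥ p`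
passes the bound to the error. -/

theorem dotProduct_self_nonneg_real (x : Fin m → ℝ) : 0 ≤ x ⬝ᵥ x :=
  Finset.sum_nonneg fun i _ => mul_self_nonneg (x i)

theorem dotProduct_mulVec_swap {A : Matrix (Fin m) (Fin m) ℝ} (hA : Aᵀ = A) (x y : Fin m → ℝ) :
    x ⬝ᵥ A *ᵥ y = y ⬝ᵥ A *ᵥ x := by
  rw [dotProduct_mulVec, ← mulVec_transpose, hA, dotProduct_comm]

theorem mulVec_transpose_dotProduct (A : Matrix (Fin m) (Fin n) ℝ) (x : Fin m → ℝ)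
    (y : Fin n → ℝ) : (Aᵀ *ᵥ x) ⬝ᵥ y = x ⬝ᵥ A *ᵥ y := by
  rw [dotProduct_mulVec, mulVec_transpose]

theorem mulVec_dotProduct_mulVec (A : Matrix (Fin m) (Fin n) ℝ) (x : Fin m → ℝ) :
    (Aᵀ *ᵥ x) ⬝ᵥ (Aᵀ *ᵥ x) = x ⬝ᵥ (A * Aᵀ) *ᵥ x := by
  rw [mulVec_transpose_dotProduct, mulVec_mulVec]

theorem Matrix.PosSemidef.quadForm_nonneg {A : Matrix (Fin m) (Fin m) ℝ} (hA : A.PosSemidef)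
    (x : Fin m → ℝ) : 0 ≤ x ⬝ᵥ A *ᵥ x := by
  simpa using hA.dotProduct_mulVec_nonneg x

theorem Matrix.IsHermitian.transpose_eq_real {A : Matrix (Fin m) (Fin m) ℝ}
    (hA : A.IsHermitian) : Aᵀ = A := by
  simpa [Matrix.IsHermitian, conjTranspose_eq_transpose_of_trivial] using hA

namespace LoewnerBetween

variable {a b : ℝ} {A : Matrix (Fin m) (Fin m) ℝ}

theorem transpose_eq (h : LoewnerBetween a b A) : Aᵀ = A := by
  have := h.1.1.transpose_eq_real
  simpa using this

theorem lower (h : LoewnerBetween a b A) (x : Fin m → ℝ) : a * (x ⬝ᵥ x) ≤ x ⬝ᵥ A *ᵥ x := by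
  have := h.1.quadForm_nonneg x
  simpa [sub_mulVec, smul_mulVec, dotProduct_sub, dotProduct_smul] using this

theorem upper (h : LoewnerBetween a b A) (x : Fin m → ℝ) : x ⬝ᵥ A *ᵥ x ≤ b * (x ⬝ᵥ x) := by
  have := h.2.quadForm_nonneg x
  simpa [sub_mulVec, smul_mulVec, dotProduct_sub, dotProduct_smul] using this

theorem posDef (h : LoewnerBetween a b A) (ha : 0 < a) : A.PosDef := by
  have h1 : (a • (1 : Matrix (Fin m) (Fin m) ℝ)).PosDef := Matrix.PosDef.one.smul ha
  simpa using h1.posSemidef_add h.1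

theorem diag_le (h : LoewnerBetween a b A) (i : Fin m) : A i i ≤ b := by
  have := h.2.diag_nonneg (i := i)
  simpa using this

end LoewnerBetween

/-- The inverse of a matrix bounded below by `a` is bounded above by `a⁻¹`. -/
theorem mul_dotProduct_le_of_mulVec_eq {A : Matrix (Fin m) (Fin m) ℝ} {a : ℝ} (ha : 0 ≤ a)
    (hA : ∀ x : Fin m → ℝ, a * (x ⬝ᵥ x) ≤ x ⬝ᵥ A *ᵥ x) {h y : Fin m → ℝ} (hy : A *ᵥ h = y) :
    a * (h ⬝ᵥ y) ≤ y ⬝ᵥ y := by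
  have h1 := hA h
  rw [hy] at h1
  -- Expanding this square and using `a² |h|² ≤ a (h ⬝ᵥ y)` gives the claim without inverting `A`.
  have h2 := dotProduct_self_nonneg_real (y - a • h)
  simp only [dotProduct_sub, sub_dotProduct, dotProduct_smul, smul_dotProduct, smul_eq_mul,
    dotProduct_comm y h] at h2
  nlinarith

/-- The inverse of a matrix bounded below by `a` has norm at most `a⁻¹`. -/
theorem sq_mul_dotProduct_le_of_mulVec_eq {A : Matrix (Fin m) (Fin m) ℝ} {a : ℝ} (ha : 0 ≤ a)
    (hA : ∀ x : Fin m → ℝ, a * (x ⬝ᵥ x) ≤ x ⬝ᵥ A *ᵥ x) {h y : Fin m → ℝ} (hy : A *ᵥ h = y) :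
    a ^ 2 * (h ⬝ᵥ h) ≤ y ⬝ᵥ y := by
  have h1 := hA h
  rw [hy] at h1
  have h2 := mul_dotProduct_le_of_mulVec_eq ha hA hy
  nlinarith

/-- Adding information does not increase the weighted error. -/
theorem quadForm_le_of_add_mulVec_eq {P N : Matrix (Fin m) (Fin m) ℝ} (hP : P.PosSemidef)
    (hN : ∀ x : Fin m → ℝ, 0 ≤ x ⬝ᵥ N *ᵥ x) {c u : Fin m → ℝ} (h : (P + N) *ᵥ c = P *ᵥ u) :
    c ⬝ᵥ (P + N) *ᵥ c ≤ u ⬝ᵥ P *ᵥ u := by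
  have h1 := hP.quadForm_nonneg (c - u)
  have h2 := hN c
  have h3 : c ⬝ᵥ P *ᵥ c + c ⬝ᵥ N *ᵥ c = c ⬝ᵥ P *ᵥ u := by
    rw [← h, add_mulVec, dotProduct_add]
  rw [add_mulVec, dotProduct_add]
  simp only [mulVec_sub, dotProduct_sub, sub_dotProduct,
    dotProduct_mulVec_swap hP.1.transpose_eq_real u c] at h1
  linarith

/-- Young's inequality: the right side minus the left is the form at `(1 - t) x - t y`, divided by
`t (1 - t)`. It absorbs the cross terms between error and noise. -/
theorem quadForm_add_le {A : Matrix (Fin m) (Fin m) ℝ} (hA : A.PosSemidef) {t : ℝ} (ht : 0 < t)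
    (ht' : t < 1) (x y : Fin m → ℝ) :
    (x + y) ⬝ᵥ A *ᵥ (x + y) ≤ x ⬝ᵥ A *ᵥ x / t + y ⬝ᵥ A *ᵥ y / (1 - t) := by
  have h1 := hA.quadForm_nonneg ((1 - t) • x - t • y)
  have h2 : 0 < 1 - t := by linarith
  rw [div_add_div _ _ ht.ne' h2.ne', le_div_iff₀ (mul_pos ht h2)]
  simp only [mulVec_sub, mulVec_add, mulVec_smul, dotProduct_sub, dotProduct_add, sub_dotProduct,
    add_dotProduct, dotProduct_smul, smul_dotProduct, smul_eq_mul,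
    dotProduct_mulVec_swap hA.1.transpose_eq_real y x] at h1 ⊢
  nlinarith

/-- The time update of the information matrix contracts the weighted error, uniformly. -/
theorem quadForm_predict_le {Ω F Q P : Matrix (Fin m) (Fin m) ℝ} {p q f : ℝ} (hp : 0 < p)
    (hq : 0 ≤ q) (hf : 0 < f) (hΩ : Ω.PosDef)
    (hΩp : ∀ x : Fin m → ℝ, p * (x ⬝ᵥ x) ≤ x ⬝ᵥ Ω *ᵥ x)
    (hQ : ∀ x : Fin m → ℝ, q * (x ⬝ᵥ x) ≤ x ⬝ᵥ Q *ᵥ x)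
    (hF : ∀ x : Fin m → ℝ, x ⬝ᵥ (F * Fᵀ) *ᵥ x ≤ f * (x ⬝ᵥ x))
    (hP : (Q + F * Ω⁻¹ * Fᵀ) * P = 1) (e : Fin m → ℝ) :
    (1 + q * p / f) * ((F *ᵥ e) ⬝ᵥ P *ᵥ (F *ᵥ e)) ≤ e ⬝ᵥ Ω *ᵥ e := by
  -- With these `g` and `h`, the form to be bounded equals both `h ⬝ᵥ Ω e` and `g ⬝ᵥ Q g + h ⬝ᵥ Ω
  -- h`.
  set g := P *ᵥ (F *ᵥ e) with hg
  set h := Ω⁻¹ *ᵥ (Fᵀ *ᵥ g) with hh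
  have hdet : IsUnit Ω.det := (Matrix.isUnit_iff_isUnit_det Ω).1 hΩ.isUnit
  have hΩh : Ω *ᵥ h = Fᵀ *ᵥ g := by
    rw [hh, mulVec_mulVec, Matrix.mul_nonsing_inv _ hdet, one_mulVec]
  have hFe : F *ᵥ e = Q *ᵥ g + F *ᵥ h := by
    have hA : (Q + F * Ω⁻¹ * Fᵀ) *ᵥ g = F *ᵥ e := by rw [hg, mulVec_mulVec, hP, one_mulVec]
    rw [← hA, add_mulVec, hh]
    simp only [mulVec_mulVec, Matrix.mul_assoc]
  have hT1 : (F *ᵥ e) ⬝ᵥ g = h ⬝ᵥ Ω *ᵥ e := by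
    rw [dotProduct_mulVec_swap hΩ.1.transpose_eq_real, hΩh, dotProduct_comm e,
      mulVec_transpose_dotProduct, dotProduct_comm]
  have hT2 : (F *ᵥ e) ⬝ᵥ g = g ⬝ᵥ Q *ᵥ g + h ⬝ᵥ Ω *ᵥ h := by
    rw [hFe, add_dotProduct, dotProduct_comm _ g, dotProduct_comm _ g, hΩh,
      dotProduct_comm h, mulVec_transpose_dotProduct]
  have h1 := hQ g
  have h2 := mul_dotProduct_le_of_mulVec_eq hp.le hΩp hΩh
  rw [mulVec_dotProduct_mulVec] at h2
  have h3 := h2.trans (hF g)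
  rw [← hΩh] at h3
  -- Write `κ = 1 + q p / f` and `T` for the predicted form. This square reads `κ² (h ⬝ᵥ Ω h) - 2 κ
  -- T + e ⬝ᵥ Ω e ≥ 0`. Since `h5` gives `κ (h ⬝ᵥ Ω h) ≤ T`, it follows that `κ T ≤ e ⬝ᵥ Ω e`.
  have h4 := hΩ.posSemidef.quadForm_nonneg ((1 + q * p / f) • h - e)
  simp only [mulVec_sub, mulVec_smul, dotProduct_sub, sub_dotProduct, dotProduct_smul,
    smul_dotProduct, smul_eq_mul, dotProduct_mulVec_swap hΩ.1.transpose_eq_real e h,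
    ← hT1] at h4
  have h5 : q * p / f * (h ⬝ᵥ Ω *ᵥ h) ≤ g ⬝ᵥ Q *ᵥ g := by
    refine le_trans ?_ h1
    rw [div_mul_eq_mul_div, div_le_iff₀ hf]
    nlinarith
  have h6 : 0 ≤ q * p / f := by positivity
  nlinarith

theorem quadForm_predict_noise_le {A Q P : Matrix (Fin m) (Fin m) ℝ} {q : ℝ} (hq : 0 ≤ q)
    (hA : A.PosSemidef) (hQ : ∀ x : Fin m → ℝ, q * (x ⬝ᵥ x) ≤ x ⬝ᵥ Q *ᵥ x)
    (hP : (Q + A) * P = 1) (w : Fin m → ℝ) : q * (w ⬝ᵥ P *ᵥ w) ≤ w ⬝ᵥ w := by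
  rw [dotProduct_comm]
  refine mul_dotProduct_le_of_mulVec_eq (A := Q + A) hq (fun x => ?_) ?_
  · rw [add_mulVec, dotProduct_add]
    linarith [hQ x, hA.quadForm_nonneg x]
  · rw [mulVec_mulVec, hP, one_mulVec]

end QuadraticForms

/-! ### Algebra of the filter: consensus, time update, error dynamics. -/

namespace CMData

variable {V : Type*} {n : ℕ} (D : CMData V n)

/-- Rows of `Pi` are convex weights. This is applied to the cone of nonnegative forms and to a ball
containing all noise innovations. -/
theorem consensus_mem [Fintype V] [DecidableEq V] {E : Type*} [AddCommGroup E] [Module ℝ E]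
    (hPi : D.Pi ∈ doublyStochastic ℝ V) {C : Set E} (hC : Convex ℝ C) {a : V → E}
    (ha : ∀ j, a j ∈ C) (l : ℕ) (s : V) : D.consensus a l s ∈ C := by
  induction l generalizing s with
  | zero => exact ha s
  | succ l ih =>
    exact hC.sum_mem (fun j _ => nonneg_of_mem_doublyStochastic hPi)
      (sum_row_of_mem_doublyStochastic hPi s) fun j _ => ih j

theorem consensus_add [Fintype V] {E : Type*} [AddCommMonoid E] [Module ℝ E] (a b : V → E)
    (l : ℕ) (s : V) :
    D.consensus (fun j => a j + b j) l s = D.consensus a l s + D.consensus b l s := by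
  induction l generalizing s with
  | zero => rfl
  | succ l ih => simp [consensus, ih, smul_add, Finset.sum_add_distrib]

theorem consensus_mulVec [Fintype V] (a : V → Matrix (Fin n) (Fin n) ℝ) (x : Fin n → ℝ)
    (l : ℕ) (s : V) : D.consensus (fun j => a j *ᵥ x) l s = D.consensus a l s *ᵥ x := by
  induction l generalizing s with
  | zero => rfl
  | succ l ih => simp [consensus, ih, sum_mulVec, smul_mulVec]

theorem innovVec_meas (k : ℕ) (s : V) (x : Fin n → ℝ) (v : Fin 2 → ℝ) :
    D.innovVec k s (D.measMat k s *ᵥ x + v) = D.innovInfo k s *ᵥ x + D.innovVec k s v := by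
  unfold innovVec innovInfo
  split_ifs
  · rw [mulVec_add, mulVec_mulVec]
  · simp

theorem innovInfo_quadForm_nonneg {k : ℕ} {s : V} (hR : s ∈ D.sensors → (D.R k s).PosSemidef)
    (x : Fin n → ℝ) : 0 ≤ x ⬝ᵥ D.innovInfo k s *ᵥ x := by
  unfold innovInfo
  split_ifs with h
  · have := ((hR h).inv.conjTranspose_mul_mul_same (D.measMat k s)).quadForm_nonneg x
    simpa [conjTranspose_eq_transpose_of_trivial] using this
  · simp

/-- Woodbury's identity. In this covariance form the process noise appears additively, which makes
the contraction visible. -/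
theorem predictInfo_eq_inv {k : ℕ} {P : Matrix (Fin n) (Fin n) ℝ} (hP : P.PosDef)
    (hQ : (D.Q k).PosDef) :
    D.predictInfo k P = (D.Q k + D.F k * P⁻¹ * (D.F k)ᵀ)⁻¹ := by
  have hdet : IsUnit P.det := (Matrix.isUnit_iff_isUnit_det P).1 hP.isUnit
  have h : (P + (D.F k)ᵀ * (D.Q k)⁻¹ * D.F k).PosDef := by
    refine hP.add_posSemidef ?_
    simpa [conjTranspose_eq_transpose_of_trivial] using
      hQ.inv.posSemidef.conjTranspose_mul_mul_same (D.F k)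
  rw [Matrix.add_mul_mul_inv_eq_sub, Matrix.nonsing_inv_nonsing_inv _ hdet]
  · rfl
  · exact hQ.isUnit
  · exact hP.inv.isUnit
  · rw [Matrix.nonsing_inv_nonsing_inv _ hdet]
    exact h.isUnit

theorem postInfo_mulVec_estimate [Fintype V] {k : ℕ} {s : V} (h : (D.postInfo k s).PosDef)
    (xhat₁ : V → Fin n → ℝ) (y : ℕ → V → Fin 2 → ℝ) :
    D.postInfo k s *ᵥ D.estimate xhat₁ y k s =
      D.correctVec (k + 1) (D.priorVec xhat₁ y k) (y (k + 1)) s := by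
  have hdet := (Matrix.isUnit_iff_isUnit_det _).1 h.isUnit
  rw [estimate, mulVec_mulVec, Matrix.mul_nonsing_inv _ hdet, one_mulVec]

/-- Dynamics of the estimation error, in information form. -/
theorem postInfo_mulVec_error [Fintype V] {k : ℕ} {s : V} (h : (D.postInfo (k + 1) s).PosDef)
    (x₀ : Fin n → ℝ) (w : ℕ → Fin n → ℝ) (v : ℕ → V → Fin 2 → ℝ) (xhat₁ : V → Fin n → ℝ) :
    D.postInfo (k + 1) s *ᵥ (D.error x₀ w v xhat₁ (k + 1) s).ofLp =
      D.priorInfo (k + 1) s *ᵥ (D.F (k + 1) *ᵥ (D.error x₀ w v xhat₁ k s).ofLp + w (k + 1)) -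
        D.weight (k + 2) s •
          D.consensus (fun j => D.innovVec (k + 2) j (v (k + 2) j)) D.L s := by
  have h1 : D.priorVec xhat₁ (D.meas x₀ w v) (k + 1) s =
      D.priorInfo (k + 1) s *ᵥ (D.F (k + 1) *ᵥ D.estimate xhat₁ (D.meas x₀ w v) k s) := by
    simp [priorVec, estimate, mulVec_mulVec, Matrix.mul_assoc]
  -- By linearity, the state part of the measurements enters through the same averaged matrix as in
  -- `postInfo (k + 1)`, so it cancels in the error. The index `k + 2` appears because `postInfo (k
  -- + 1)` is the update at time `k + 2`.
  have h2 : D.consensus (fun j => D.innovVec (k + 1 + 1) j (D.meas x₀ w v (k + 1 + 1) j)) D.L s =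
      D.consensus (D.innovInfo (k + 2)) D.L s *ᵥ D.state x₀ w (k + 2) +
        D.consensus (fun j => D.innovVec (k + 2) j (v (k + 2) j)) D.L s := by
    simp only [meas, innovVec_meas, consensus_add, consensus_mulVec]
  simp only [error, mulVec_sub, D.postInfo_mulVec_estimate h, correctVec, h1]
  rw [h2]
  have h3 : D.postInfo (k + 1) s = D.priorInfo (k + 1) s +
      D.weight (k + 2) s • D.consensus (D.innovInfo (k + 2)) D.L s := rfl
  have h4 : D.state x₀ w (k + 1 + 1) = D.F (k + 1) *ᵥ D.state x₀ w (k + 1) + w (k + 1) := rfl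
  rw [h3, add_mulVec, smul_mulVec, h4]
  simp only [mulVec_add, mulVec_sub, smul_add]
  abel

/-- The factors `R⁻¹`, `βᵀ` and `Hᵀ` multiply squared norms by at most `1 / r ^ 2`, `b` and `h`. -/
theorem innovVec_dotProduct_le {k : ℕ} {s : V} {b h r : ℝ} (hr : 0 < r) (hh : 0 ≤ h)
    (hb : ∀ x : Fin 2 → ℝ, x ⬝ᵥ (D.comp k s * (D.comp k s)ᵀ) *ᵥ x ≤ b * (x ⬝ᵥ x))
    (hb0 : 0 ≤ b)
    (hH : ∀ x : Fin 2 → ℝ, x ⬝ᵥ (D.H * D.Hᵀ) *ᵥ x ≤ h * (x ⬝ᵥ x))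
    (hRp : (D.R k s).PosDef)
    (hR : ∀ x : Fin 2 → ℝ, r * (x ⬝ᵥ x) ≤ x ⬝ᵥ D.R k s *ᵥ x) (v : Fin 2 → ℝ) :
    D.innovVec k s v ⬝ᵥ D.innovVec k s v ≤ h * b / r ^ 2 * (v ⬝ᵥ v) := by
  unfold innovVec
  split_ifs
  · set u := (D.R k s)⁻¹ *ᵥ v with hu
    have hdet := (Matrix.isUnit_iff_isUnit_det _).1 hRp.isUnit
    have h1 : r ^ 2 * (u ⬝ᵥ u) ≤ v ⬝ᵥ v := by
      refine sq_mul_dotProduct_le_of_mulVec_eq hr.le hR ?_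
      rw [hu, mulVec_mulVec, Matrix.mul_nonsing_inv _ hdet, one_mulVec]
    have h2 : ((D.measMat k s)ᵀ * (D.R k s)⁻¹) *ᵥ v = D.Hᵀ *ᵥ ((D.comp k s)ᵀ *ᵥ u) := by
      rw [hu, mulVec_mulVec, mulVec_mulVec, measMat, Matrix.transpose_mul, Matrix.mul_assoc]
    have h3 := hH ((D.comp k s)ᵀ *ᵥ u)
    have h4 := hb u
    rw [← mulVec_dotProduct_mulVec] at h3 h4
    rw [h2, div_mul_eq_mul_div, le_div_iff₀ (by positivity)]
    calc _ ≤ h * (b * (u ⬝ᵥ u)) * r ^ 2 := by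
          gcongr
          exact h3.trans (by gcongr)
      _ = h * b * (r ^ 2 * (u ⬝ᵥ u)) := by ring
      _ ≤ _ := by gcongr
  · have := dotProduct_self_nonneg_real v
    simp only [dotProduct_zero]
    positivity

end CMData

theorem convex_dotProduct_self_le {m : ℕ} (B : ℝ) :
    Convex ℝ {x : Fin m → ℝ | x ⬝ᵥ x ≤ B} := by
  intro x hx y hy a b ha hb hab
  have h := dotProduct_self_nonneg_real (x - y)
  simp only [Set.mem_ofPred_eq, dotProduct_sub, sub_dotProduct, dotProduct_add, add_dotProduct,
    dotProduct_smul, smul_dotProduct, smul_eq_mul, dotProduct_comm y x] at *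
  obtain rfl : b = 1 - a := by linarith
  nlinarith [mul_nonneg ha hb]

theorem convex_quadForm_nonneg {m : ℕ} :
    Convex ℝ {A : Matrix (Fin m) (Fin m) ℝ | ∀ x : Fin m → ℝ, 0 ≤ x ⬝ᵥ A *ᵥ x} := by
  intro A hA B hB a b ha hb _ x
  simp only [add_mulVec, smul_mulVec, dotProduct_add, dotProduct_smul, smul_eq_mul]
  exact add_nonneg (mul_nonneg ha (hA x)) (mul_nonneg hb (hB x))

/-- One step of the weighted error recursion, with the noise split off. -/
theorem quadForm_step_le {m : ℕ} {Ω P N F : Matrix (Fin m) (Fin m) ℝ} {κ p q t : ℝ}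
    (hκ : 0 < κ) (hp : 0 < p) (hq : 0 < q) (ht : 0 < t) (ht' : t < 1)
    (hP : P.PosSemidef) (hN : ∀ x : Fin m → ℝ, 0 ≤ x ⬝ᵥ N *ᵥ x) (hPN : (P + N).PosDef)
    (hPNp : ∀ x : Fin m → ℝ, p * (x ⬝ᵥ x) ≤ x ⬝ᵥ (P + N) *ᵥ x)
    (hpred : ∀ e : Fin m → ℝ, κ * ((F *ᵥ e) ⬝ᵥ P *ᵥ (F *ᵥ e)) ≤ e ⬝ᵥ Ω *ᵥ e)
    (hnoise : ∀ w : Fin m → ℝ, q * (w ⬝ᵥ P *ᵥ w) ≤ w ⬝ᵥ w) {e e' w ν : Fin m → ℝ}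
    (he : (P + N) *ᵥ e' = P *ᵥ (F *ᵥ e + w) - ν) :
    e' ⬝ᵥ (P + N) *ᵥ e' ≤
      1 / (κ * t) * (e ⬝ᵥ Ω *ᵥ e) + 2 / (1 - t) * (w ⬝ᵥ w / q + ν ⬝ᵥ ν / p) := by
  have hdet := (Matrix.isUnit_iff_isUnit_det _).1 hPN.isUnit
  have hinv : ∀ y, (P + N) *ᵥ ((P + N)⁻¹ *ᵥ y) = y := fun y => by
    rw [mulVec_mulVec, Matrix.mul_nonsing_inv _ hdet, one_mulVec]
  have hinv' : ∀ y, (P + N)⁻¹ *ᵥ ((P + N) *ᵥ y) = y := fun y => by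
    rw [mulVec_mulVec, Matrix.nonsing_inv_mul _ hdet, one_mulVec]
  -- The new error splits into contributions of the old error, the process noise and the measurement
  -- noise.
  set a := (P + N)⁻¹ *ᵥ (P *ᵥ (F *ᵥ e)) with ha
  set b := (P + N)⁻¹ *ᵥ (P *ᵥ w) with hb
  set d := (P + N)⁻¹ *ᵥ (-ν) with hd
  have hsum : e' = a + (b + d) := by
    rw [← hinv' e', he, ha, hb, hd, ← mulVec_add, ← mulVec_add, mulVec_add P]
    congr 1
    abel
  have h1 := quadForm_le_of_add_mulVec_eq hP hN (hinv (P *ᵥ (F *ᵥ e)))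
  have h2 := quadForm_le_of_add_mulVec_eq hP hN (hinv (P *ᵥ w))
  have h3 := mul_dotProduct_le_of_mulVec_eq hp.le hPNp (hinv (-ν))
  rw [← ha] at h1
  rw [← hb] at h2
  rw [← hd, neg_dotProduct_neg] at h3
  have h4 := quadForm_add_le hPN.posSemidef ht ht' a (b + d)
  have h5 := quadForm_add_le hPN.posSemidef (t := 1 / 2) (by norm_num) (by norm_num) b d
  have h6 : a ⬝ᵥ (P + N) *ᵥ a ≤ 1 / κ * (e ⬝ᵥ Ω *ᵥ e) := by
    rw [one_div_mul_eq_div, le_div_iff₀ hκ]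
    linarith [mul_le_mul_of_nonneg_left h1 hκ.le, hpred e]
  have h7 : b ⬝ᵥ (P + N) *ᵥ b ≤ w ⬝ᵥ w / q := by
    rw [le_div_iff₀ hq]
    linarith [mul_le_mul_of_nonneg_left h2 hq.le, hnoise w]
  have h8 : d ⬝ᵥ (P + N) *ᵥ d ≤ ν ⬝ᵥ ν / p := by
    rw [le_div_iff₀ hp, hd, hinv, ← hd]
    linarith
  have h9 : 0 < 1 - t := by linarith
  rw [← hsum] at h4
  calc _ ≤ _ := h4
    _ ≤ (1 / κ * (e ⬝ᵥ Ω *ᵥ e)) / t + (2 * (w ⬝ᵥ w / q + ν ⬝ᵥ ν / p)) / (1 - t) := by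
        gcongr
        rw [div_eq_mul_inv, div_eq_mul_inv] at h5
        norm_num only at h5
        linarith
    _ = _ := by
        field_simp

/-! ### Square integrability and second moments. -/

section SquareIntegrable

variable {S : Type*} [MeasurableSpace S] {μ : Measure S} {m n : ℕ}

theorem MeasureTheory.MemLp.mulVec_const {X : S → Fin n → ℝ} (hX : MemLp X 2 μ)
    (A : Matrix (Fin m) (Fin n) ℝ) : MemLp (fun z => A *ᵥ X z) 2 μ :=
  (LinearMap.toContinuousLinearMap A.mulVecLin).comp_memLp' hX

theorem MeasureTheory.MemLp.integrable_dotProduct {X Y : S → Fin n → ℝ} (hX : MemLp X 2 μ)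
    (hY : MemLp Y 2 μ) : Integrable (fun z => X z ⬝ᵥ Y z) μ :=
  integrable_finsetSum _ fun i _ => (hX.eval i).integrable_mul (hY.eval i)

theorem IsZeroMeanNoise.memLp {X : S → Fin n → ℝ} {C : Matrix (Fin n) (Fin n) ℝ}
    (h : IsZeroMeanNoise μ X C) : MemLp X 2 μ :=
  MemLp.of_eval h.1

theorem IsZeroMeanNoise.integral_dotProduct_self {X : S → Fin n → ℝ}
    {C : Matrix (Fin n) (Fin n) ℝ} (h : IsZeroMeanNoise μ X C) :
    ∫ z, X z ⬝ᵥ X z ∂μ = ∑ i, C i i := by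
  simp only [dotProduct]
  rw [integral_finsetSum _ fun i _ =>
    show Integrable (fun z => X z i * X z i) μ from (h.1 i).integrable_mul (h.1 i)]
  refine Finset.sum_congr rfl fun i _ => ?_
  have hm := (h.1 i).aestronglyMeasurable.aemeasurable
  rw [← h.2.2 i i, covariance_self hm, variance_of_integral_eq_zero hm (h.2.1 i)]
  simp only [pow_two]

theorem IsZeroMeanNoise.integral_dotProduct_self_le {X : S → Fin n → ℝ}
    {C : Matrix (Fin n) (Fin n) ℝ} (h : IsZeroMeanNoise μ X C) {a b : ℝ}
    (hC : LoewnerBetween a b C) : ∫ z, X z ⬝ᵥ X z ∂μ ≤ n * b := by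
  rw [h.integral_dotProduct_self]
  simpa using Finset.sum_le_card_nsmul Finset.univ (fun i => C i i) b fun i _ => hC.diag_le i

end SquareIntegrable

namespace CMData

variable {V : Type*} {n : ℕ} (D : CMData V n) {S : Type*} [MeasurableSpace S]
  {μ : Measure S}

theorem memLp_consensus [Fintype V] {a : S → V → Fin n → ℝ} (ha : ∀ j, MemLp (fun z => a z j) 2 μ) (l : ℕ)
    (s : V) : MemLp (fun z => D.consensus (a z) l s) 2 μ := by
  induction l generalizing s with
  | zero => exact ha s
  | succ l ih => exact memLp_finsetSum _ fun j _ => (ih j).const_smul (D.Pi s j)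

theorem memLp_innovVec {k : ℕ} {s : V} {y : S → Fin 2 → ℝ}
    (hy : s ∈ D.sensors → MemLp y 2 μ) : MemLp (fun z => D.innovVec k s (y z)) 2 μ := by
  unfold innovVec
  split_ifs with h
  · exact (hy h).mulVec_const _
  · exact MemLp.zero

theorem memLp_correctVec [Fintype V] {k : ℕ} {q : S → V → Fin n → ℝ} {y : S → V → Fin 2 → ℝ}
    (hq : ∀ s, MemLp (fun z => q z s) 2 μ)
    (hy : ∀ s ∈ D.sensors, MemLp (fun z => y z s) 2 μ) (s : V) :
    MemLp (fun z => D.correctVec k (q z) (y z) s) 2 μ :=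
  (hq s).add ((D.memLp_consensus (a := fun z j => D.innovVec k j (y z j))
    (fun j => D.memLp_innovVec (hy j)) D.L s).const_smul (D.weight k s))

theorem memLp_priorVec [Fintype V] {xhat₁ : V → S → Fin n → ℝ} {y : S → ℕ → V → Fin 2 → ℝ}
    (hx : ∀ s, MemLp (xhat₁ s) 2 μ)
    (hy : ∀ k, ∀ s ∈ D.sensors, MemLp (fun z => y z k s) 2 μ) (k : ℕ) (s : V) :
    MemLp (fun z => D.priorVec (fun j => xhat₁ j z) (y z) k s) 2 μ := by
  induction k generalizing s with
  | zero => exact (hx s).mulVec_const _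
  | succ k ih => exact (D.memLp_correctVec ih (hy (k + 1)) s).mulVec_const _

theorem memLp_state {x₀ : S → Fin n → ℝ} {w : ℕ → S → Fin n → ℝ} (hx : MemLp x₀ 2 μ)
    (hw : ∀ k, MemLp (w k) 2 μ) (k : ℕ) :
    MemLp (fun z => D.state (x₀ z) (fun k => w k z) k) 2 μ := by
  induction k with
  | zero => exact hx
  | succ k ih => exact (ih.mulVec_const _).add (hw k)

theorem memLp_error [Fintype V] {x₀ : S → Fin n → ℝ} {w : ℕ → S → Fin n → ℝ} {v : ℕ → V → S → Fin 2 → ℝ}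
    {xhat₁ : V → S → Fin n → ℝ} (hx₀ : MemLp x₀ 2 μ) (hw : ∀ k, MemLp (w k) 2 μ)
    (hv : ∀ k, ∀ s ∈ D.sensors, MemLp (v k s) 2 μ) (hx : ∀ s, MemLp (xhat₁ s) 2 μ)
    (k : ℕ) (s : V) :
    MemLp (fun z => (D.error (x₀ z) (fun k => w k z) (fun k j => v k j z)
      (fun j => xhat₁ j z) k s).ofLp) 2 μ := by
  have hst := D.memLp_state hx₀ hw
  have hy : ∀ k, ∀ s ∈ D.sensors,
      MemLp (fun z => D.meas (x₀ z) (fun k => w k z) (fun k j => v k j z) k s) 2 μ :=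
    fun k s hs => ((hst k).mulVec_const _).add (hv k s hs)
  exact (hst (k + 1)).sub
    ((D.memLp_correctVec (D.memLp_priorVec hx hy k) (hy (k + 1)) s).mulVec_const _)

end CMData

/-! ### Mean-square boundedness. -/

/-- A sequence with `a (k + 1) ≤ r * a k + c`, `r < 1`, is bounded. -/
theorem le_add_div_of_affine_recursion {a : ℕ → ℝ} {r c : ℝ} (hr : 0 ≤ r) (hr' : r < 1)
    (ha : 0 ≤ a 0) (hc : 0 ≤ c) (h : ∀ k, a (k + 1) ≤ r * a k + c) (k : ℕ) :
    a k ≤ a 0 + c / (1 - r) := by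
  have h1 : 0 < 1 - r := by linarith
  induction k with
  | zero => simpa using div_nonneg hc h1.le
  | succ k ih =>
    have h2 : c / (1 - r) = r * (c / (1 - r)) + c := by field_simp; ring
    nlinarith [h k, mul_le_mul_of_nonneg_left ih hr]

theorem enorm_sq_eq_ofReal_dotProduct {n : ℕ} (x : EuclideanSpace ℝ (Fin n)) :
    ‖x‖ₑ ^ 2 = ENNReal.ofReal (x.ofLp ⬝ᵥ x.ofLp) := by
  rw [← ofReal_norm, ← ENNReal.ofReal_pow (norm_nonneg _), EuclideanSpace.norm_sq_eq]
  simp [dotProduct, pow_two]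

theorem theorem1 {V : Type*} [Fintype V] [DecidableEq V] {n : ℕ} (D : CMData V n)
    {S : Type*} [MeasurableSpace S] (μ : Measure S) [IsProbabilityMeasure μ]
    -- initial state, process noise, measurement noise, initial estimates
    (x₀ : S → Fin n → ℝ) (w : ℕ → S → Fin n → ℝ) (v : ℕ → V → S → Fin 2 → ℝ)
    (xhat₁ : V → S → Fin n → ℝ)
    (hx₀ : ∀ i, MemLp (fun z => x₀ z i) 2 μ)
    (hxhat₁ : ∀ s i, MemLp (fun z => xhat₁ s z i) 2 μ)
    (hw : ∀ k, IsZeroMeanNoise μ (w k) (D.Q k))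
    (hv : ∀ k, ∀ s ∈ D.sensors, IsZeroMeanNoise μ (v k s) (D.R k s))
    -- bounds on the compensation, transition and measurement matrices
    (βlo βhi flo fhi hlo hhi : ℝ)
    (hβlo : βlo ≠ 0) (hβhi : βhi ≠ 0) (hflo : flo ≠ 0) (hfhi : fhi ≠ 0)
    (hhlo : hlo ≠ 0) (hhhi : hhi ≠ 0)
    (hβ : ∀ k, ∀ s ∈ D.sensors,
      LoewnerBetween (βlo ^ 2) (βhi ^ 2) (D.comp k s * (D.comp k s)ᵀ))
    (hF : ∀ k, LoewnerBetween (flo ^ 2) (fhi ^ 2) (D.F k * (D.F k)ᵀ))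
    (hH : LoewnerBetween (hlo ^ 2) (hhi ^ 2) (D.H * D.Hᵀ))
    -- bounds on the weights, the noise covariances and the information matrices
    (ωlo ωhi qlo qhi rlo rhi plo phi : ℝ)
    (hωlo : 0 < ωlo) (hωhi : ωlo ≤ ωhi) (hqlo : 0 < qlo) (hqhi : qlo ≤ qhi)
    (hrlo : 0 < rlo) (hrhi : rlo ≤ rhi) (hplo : 0 < plo) (hphi : plo ≤ phi)
    (hω : ∀ k s, ωlo ≤ D.weight k s ∧ D.weight k s ≤ ωhi)
    (hQ : ∀ k, LoewnerBetween qlo qhi (D.Q k))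
    (hR : ∀ k, ∀ s ∈ D.sensors, LoewnerBetween rlo rhi (D.R k s))
    (hinfo : ∀ k s, LoewnerBetween plo phi (D.postInfo k s))
    -- the consensus matrix is doubly stochastic and primitive
    (hPi : D.Pi ∈ doublyStochastic ℝ V) (hPi' : D.Pi.IsPrimitive)
    (hL : 1 < D.L) (hinfo₁ : ∀ s, (D.info₁ s).PosDef) :
    ∀ s : V,
      (∀ k, MemLp (fun z => D.error (x₀ z) (fun k => w k z) (fun k j => v k j z)
        (fun j => xhat₁ j z) k s) 2 μ) ∧
      limsup (fun k : ℕ => ∫⁻ z, ‖D.error (x₀ z) (fun k => w k z) (fun k j => v k j z)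
        (fun j => xhat₁ j z) k s‖ₑ ^ 2 ∂μ) atTop < ⊤ := by
  classical
  intro s
  set e : ℕ → S → EuclideanSpace ℝ (Fin n) := fun k z =>
    D.error (x₀ z) (fun k => w k z) (fun k j => v k j z) (fun j => xhat₁ j z) k s with he
  have hw2 : ∀ k, MemLp (w k) 2 μ := fun k => (hw k).memLp
  have hv2 : ∀ k, ∀ s ∈ D.sensors, MemLp (v k s) 2 μ := fun k s hs => (hv k s hs).memLp
  have hmem : ∀ k, MemLp (fun z => (e k z).ofLp) 2 μ := fun k =>
    D.memLp_error (MemLp.of_eval hx₀) hw2 hv2 (fun s => MemLp.of_eval (hxhat₁ s)) k s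
  refine ⟨fun k => MemLp.of_eval_piLp fun i => (hmem k).eval i, ?_⟩
  set κ : ℝ := 1 + qlo * plo / fhi ^ 2 with hκdef
  have hf : 0 < fhi ^ 2 := by positivity
  have hκ : 1 < κ := by
    have : 0 < qlo * plo / fhi ^ 2 := by positivity
    linarith
  -- Taking `t > κ⁻¹` keeps `κ t > 1`, so the Young loss `1 / t` does not destroy the contraction.
  obtain ⟨t, ht1, ht2⟩ := exists_between (inv_lt_one_of_one_lt₀ hκ)
  have hκ0 : 0 < κ := by linarith
  have ht0 : 0 < t := (inv_pos.2 hκ0).trans ht1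
  set c : ℝ := hhi ^ 2 * βhi ^ 2 / rlo ^ 2 with hc
  -- Nothing is assumed about `v k j` at communication nodes, so the noise sums run over sensors
  -- only.
  set sens : Finset V := Finset.univ.filter (· ∈ D.sensors) with hsens
  set g : ℕ → S → ℝ := fun k z => 2 / (1 - t) * (w (k + 1) z ⬝ᵥ w (k + 1) z / qlo +
    ωhi ^ 2 * (c * ∑ j ∈ sens, v (k + 2) j z ⬝ᵥ v (k + 2) j z) / plo) with hg
  set W : ℕ → S → ℝ := fun k z => (e k z).ofLp ⬝ᵥ D.postInfo k s *ᵥ (e k z).ofLp with hW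
  have hpd : ∀ k s, (D.postInfo k s).PosDef := fun k s => (hinfo k s).posDef hplo
  -- pointwise recursion
  have hstep : ∀ k z, W (k + 1) z ≤ 1 / (κ * t) * W k z + g k z := by
    intro k z
    have hQpd := (hQ (k + 1)).posDef hqlo
    have hApsd : (D.F (k + 1) * (D.postInfo k s)⁻¹ * (D.F (k + 1))ᵀ).PosSemidef := by
      simpa [conjTranspose_eq_transpose_of_trivial] using
        (hpd k s).inv.posSemidef.mul_mul_conjTranspose_same (D.F (k + 1))
    have hApd := hQpd.add_posSemidef hApsd
    have hprior : D.priorInfo (k + 1) s =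
        (D.Q (k + 1) + D.F (k + 1) * (D.postInfo k s)⁻¹ * (D.F (k + 1))ᵀ)⁻¹ :=
      D.predictInfo_eq_inv (hpd k s) hQpd
    have hinv : (D.Q (k + 1) + D.F (k + 1) * (D.postInfo k s)⁻¹ * (D.F (k + 1))ᵀ) *
        D.priorInfo (k + 1) s = 1 := by
      rw [hprior, Matrix.mul_nonsing_inv _ ((Matrix.isUnit_iff_isUnit_det _).1 hApd.isUnit)]
    have hpsd : (D.priorInfo (k + 1) s).PosSemidef := hprior ▸ hApd.inv.posSemidef
    have hN : ∀ x : Fin n → ℝ, 0 ≤ x ⬝ᵥ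
        (D.weight (k + 2) s • D.consensus (D.innovInfo (k + 2)) D.L s) *ᵥ x := by
      intro x
      rw [smul_mulVec, dotProduct_smul, smul_eq_mul]
      exact mul_nonneg (hωlo.le.trans (hω _ _).1) (D.consensus_mem hPi convex_quadForm_nonneg
        (fun j => D.innovInfo_quadForm_nonneg
          fun hj => ((hR (k + 2) j hj).posDef hrlo).posSemidef) D.L s x)
    have hν : (D.weight (k + 2) s •
        D.consensus (fun j => D.innovVec (k + 2) j (v (k + 2) j z)) D.L s) ⬝ᵥ
        (D.weight (k + 2) s •
        D.consensus (fun j => D.innovVec (k + 2) j (v (k + 2) j z)) D.L s) ≤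
        ωhi ^ 2 * (c * ∑ j ∈ sens, v (k + 2) j z ⬝ᵥ v (k + 2) j z) := by
      have hc0 : 0 ≤ c := by positivity
      have hnn : ∀ j ∈ sens, 0 ≤ v (k + 2) j z ⬝ᵥ v (k + 2) j z :=
        fun j _ => dotProduct_self_nonneg_real _
      have h1 : D.consensus (fun j => D.innovVec (k + 2) j (v (k + 2) j z)) D.L s ⬝ᵥ
          D.consensus (fun j => D.innovVec (k + 2) j (v (k + 2) j z)) D.L s ≤
          c * ∑ j ∈ sens, v (k + 2) j z ⬝ᵥ v (k + 2) j z := by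
        -- All nodes need one common ball, hence a radius built from the total noise over the
        -- sensors.
        refine D.consensus_mem hPi (convex_dotProduct_self_le _) (fun j => ?_) D.L s
        by_cases hj : j ∈ D.sensors
        · refine (D.innovVec_dotProduct_le hrlo (sq_nonneg hhi) (hβ _ j hj).upper
            (sq_nonneg βhi) hH.upper ((hR _ j hj).posDef hrlo) (hR _ j hj).lower _).trans ?_
          gcongr
          exact Finset.single_le_sum hnn (by simp [hsens, hj])
        · simp only [Set.mem_ofPred_eq, CMData.innovVec, if_neg hj,
            dotProduct_zero]
          exact mul_nonneg hc0 (Finset.sum_nonneg hnn)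
      rw [smul_dotProduct, dotProduct_smul, smul_eq_mul, smul_eq_mul, ← mul_assoc, ← pow_two]
      have h2 := hω (k + 2) s
      have h3 : 0 ≤ D.weight (k + 2) s := hωlo.le.trans h2.1
      exact mul_le_mul (pow_le_pow_left₀ h3 h2.2 2) h1 (dotProduct_self_nonneg_real _)
        (sq_nonneg _)
    refine (quadForm_step_le hκ0 hplo hqlo ht0 ht2 hpsd hN (hpd (k + 1) s)
      (hinfo (k + 1) s).lower
      (quadForm_predict_le hplo hqlo.le hf (hpd k s) (hinfo k s).lower (hQ (k + 1)).lower
        (hF (k + 1)).upper hinv)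
      (quadForm_predict_noise_le hqlo.le hApsd (hQ (k + 1)).lower hinv)
      (D.postInfo_mulVec_error (hpd (k + 1) s) (x₀ z) (fun k => w k z) (fun k j => v k j z)
        (fun j => xhat₁ j z))).trans ?_
    have h1t : 0 < 1 - t := by linarith
    simp only [hg]
    gcongr
  -- integrated recursion
  have hWint : ∀ k, Integrable (W k) μ := fun k =>
    (hmem k).integrable_dotProduct ((hmem k).mulVec_const _)
  have hwint : ∀ k, Integrable (fun z => w k z ⬝ᵥ w k z) μ := fun k =>
    (hw2 k).integrable_dotProduct (hw2 k)
  have hvint : ∀ k, ∀ j ∈ sens, Integrable (fun z => v k j z ⬝ᵥ v k j z) μ := fun k j hj =>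
    have hj : j ∈ D.sensors := by simpa [hsens] using hj
    (hv2 k j hj).integrable_dotProduct (hv2 k j hj)
  have hgint : ∀ k, Integrable (g k) μ := fun k =>
    (((hwint _).div_const _).add ((((integrable_finsetSum _ (hvint _)).const_mul _).const_mul
      _).div_const _)).const_mul _
  -- `n * qhi` and `2 * rhi` bound the traces of `Q` and `R`; measurements are planar.
  set G : ℝ := 2 / (1 - t) * (n * qhi / qlo + ωhi ^ 2 * (c * ∑ j ∈ sens, 2 * rhi) / plo)
    with hG
  have h1t : 0 < 1 - t := by linarith
  have hgle : ∀ k, ∫ z, g k z ∂μ ≤ G := by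
    intro k
    simp only [hg, hG]
    rw [integral_const_mul, integral_add ((hwint _).div_const _)
      ((((integrable_finsetSum _ (hvint _)).const_mul _).const_mul _).div_const _),
      integral_div, integral_div, integral_const_mul, integral_const_mul,
      integral_finsetSum _ (hvint _)]
    gcongr with j hj
    · exact (hw _).integral_dotProduct_self_le (hQ _)
    · have hj : j ∈ D.sensors := by simpa [hsens] using hj
      exact_mod_cast (hv _ j hj).integral_dotProduct_self_le (hR _ j hj)
  have hrec : ∀ k, ∫ z, W (k + 1) z ∂μ ≤ 1 / (κ * t) * ∫ z, W k z ∂μ + G := by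
    intro k
    refine (integral_mono (hWint _) (((hWint k).const_mul _).add (hgint k)) (hstep k)).trans ?_
    simp only [Pi.add_apply]
    rw [integral_add ((hWint k).const_mul _) (hgint k), integral_const_mul]
    linarith [hgle k]
  have hr1 : 1 / (κ * t) < 1 := by
    rw [div_lt_one (by positivity)]
    rwa [inv_lt_iff_one_lt_mul₀' hκ0] at ht1
  have hG0 : 0 ≤ G := by
    have : 0 ≤ qhi := by linarith
    have : 0 ≤ rhi := by linarith
    positivity
  have hbound := le_add_div_of_affine_recursion (a := fun k => ∫ z, W k z ∂μ) (by positivity) hr1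
    (integral_nonneg fun z => (hpd 0 s).posSemidef.quadForm_nonneg _) hG0 hrec
  set B := (∫ z, W 0 z ∂μ) + G / (1 - 1 / (κ * t)) with hB
  refine lt_of_le_of_lt (limsup_le_of_le (h := Eventually.of_forall fun k => ?_))
    (ENNReal.ofReal_lt_top (r := B / plo))
  simp only [enorm_sq_eq_ofReal_dotProduct]
  have hee : Integrable (fun z => (e k z).ofLp ⬝ᵥ (e k z).ofLp) μ :=
    (hmem k).integrable_dotProduct (hmem k)
  change ∫⁻ z, ENNReal.ofReal ((e k z).ofLp ⬝ᵥ (e k z).ofLp) ∂μ ≤ _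
  rw [← ofReal_integral_eq_lintegral_ofReal hee
    (Eventually.of_forall fun z => dotProduct_self_nonneg_real _)]
  refine ENNReal.ofReal_le_ofReal ?_
  rw [le_div_iff₀ hplo, mul_comm, ← integral_const_mul]
  exact (integral_mono (hee.const_mul _) (hWint k) fun z => (hinfo k s).lower _).trans
    (hbound k)
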